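/- Let $f:\mathbb{R}\to\mathbb{R}$ be locally Lipschitz continuous with $f(0)=0$ and $uf(u)>0$ for all $u\neq 0$. For $u>0$ put $F(u)=\int_u^1 \frac{dv}{f(v)}$, and suppose that $F(u)\to+\infty$ as $u\to 0^+$; then $F$ is strictly decreasing on $(0,\infty)$, and its inverse $F^{-1}$ is defined at least on $[0,\infty)$. Let $g:[0,\infty)\to\mathbb{R}$ be continuous with $g(t)>0$ for $t>0$, let $\xi>0$, and let $x:[0,\infty)\to\mathbb{R}$ be the (unique) continuous solution of $$x'(t)=-f(x(t))+g(t),\quad t>0;\qquad x(0)=\xi.$$ Suppose that there are $\delta>0$ and a function $\phi$ that is increasing (not necessarily strictly) on $(0,\delta)$ such that $\lim_{u\to0^+}f(u)/\phi(u)=1$, and that there is $L\in(0,\infty)$ with $$\lim_{t\to\infty}\frac{g(t)}{f(F^{-1}(t))}=L.$$ A measurable function $h$, positive on $(0,\infty)$, is in $\mathrm{RV}_0(\beta)$ if $\lim_{u\to0^+}h(cu)/h(u)=c^{\beta}$ for all $c>0$; a measurable function $h$, positive on $[0,\infty)$, is in $\mathrm{RV}_\infty(\alpha)$ if $\lim_{t\to\infty}h(ct)/h(t)=c^{\alpha}$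 for all $c>0$. Then $x(t)\to0$ as $t\to\infty$. Moreover: (i) If $f\in\mathrm{RV}_0(\beta)$ for some $\beta>1$, then the equation $(1-\Lambda)\Lambda^{-\beta/(\beta-1)}=L$ has exactly one solution $\Lambda_*$ in $(0,\infty)$; it lies in $(0,1)$, and $$\lim_{t\to\infty}\frac{F(x(t))}{t}=\Lambda_*.$$ (ii) If $f\circ F^{-1}\in\mathrm{RV}_\infty(-1)$ and $F^{-1}\in\mathrm{RV}_\infty(0)$, then the equation $(1-\Lambda)\Lambda^{-1}=L$ has exactly one solution $\Lambda_*$ in $(0,\infty)$, namely $\Lambda_*=\frac{1}{1+L}\in(0,1)$, and $$\lim_{t\to\infty}\frac{F(x(t))}{t}=\Lambda_*.$$ -/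

import Mathlib

open Set Filter Topology MeasureTheory

namespace PerturbedODE

/-- `F(x) = ∫_x^1 du / f(u)`, of interest for `x > 0`. -/
noncomputable def F (f : ℝ → ℝ) (x : ℝ) : ℝ :=
  ∫ u in x..1, 1 / f u

/-- The inverse of `F : (0, ∞) → ℝ`. (When `f > 0` on `(0, ∞)`, `F` is strictly decreasing there, and
when moreover `F(x) → ∞` as `x → 0+`, its range contains `[0, ∞)`.) -/
noncomputable def Finv (f : ℝ → ℝ) : ℝ → ℝ :=
  Function.invFunOn (F f) (Ioi 0)

/-- `f ∈ RV_0(β)`: the restriction of `f` to `(0, ∞)` is measurable, positive and regularly varying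
at `0` with index `β`. -/
def RVZero (f : ℝ → ℝ) (β : ℝ) : Prop :=
  Measurable (fun x : Ioi (0 : ℝ) => f x) ∧ (∀ x, 0 < x → 0 < f x) ∧
    ∀ c : ℝ, 0 < c → Tendsto (fun x => f (c * x) / f x) (𝓝[>] 0) (𝓝 (c ^ β))

/-- `h ∈ RV_∞(α)`: the restriction of `h` to `[0, ∞)` is measurable, positive and regularly varying
at infinity with index `α`. -/
def RVInfty (h : ℝ → ℝ) (α : ℝ) : Prop :=
  Measurable (fun t : Ici (0 : ℝ) => h t) ∧ (∀ t, 0 ≤ t → 0 < h t) ∧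
    ∀ c : ℝ, 0 < c → Tendsto (fun t => h (c * t) / h t) atTop (𝓝 (c ^ α))

/-- `x` is a continuous solution on `[0, ∞)` of `x'(t) = -f(x(t)) + g(t)`, `t > 0`, `x(0) = ξ`. -/
structure IsSolution (f g : ℝ → ℝ) (ξ : ℝ) (x : ℝ → ℝ) : Prop where
  continuousOn : ContinuousOn x (Ici 0)
  initial : x 0 = ξ
  hasDerivAt : ∀ t, 0 < t → HasDerivAt x (-f (x t) + g t) t

end PerturbedODE

/-!
Along a solution, `z = F ∘ x` satisfies `z' = 1 - g / f(x)`. Put `h = 1 / (f ∘ F⁻¹)` and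
`b = g / (f ∘ F⁻¹)`. As `x = F⁻¹(z)`, the equation becomes the scalar equation
`z' = 1 - b(t) h(z(t)) / h(t)`, where `b → L`. If `h` is regularly varying at infinity with index
`γ > 0`, then at a point where `z(t) = c t` the right-hand side is close to `1 - L c ^ γ`, which
exceeds `c` when `c < Λ` and is less than `c` when `c > Λ`, `Λ` being the root of
`Λ + L Λ ^ γ = 1`. So the lines of slope different from `Λ` are eventually crossed in one direction
only, whence `z(t) / t → Λ`. Almost monotonicity of `f` turns this comparison along the line
`z = c t` into one on the whole half-plane above or below it, without any uniform convergence
theorem for regularly varying functions.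

If `f` is regularly varying at `0` with index `β > 1`, l'Hôpital's rule gives index `1 - β` for `F`;
hence `F⁻¹` has index `1 / (1 - β)` at infinity, and `h` has index `γ = β / (β - 1)`.
-/

namespace PerturbedODE

/-! ### Differential inequalities on a half-line -/

section DifferentialInequality

variable {v v' : ℝ → ℝ} {T : ℝ}

lemma sub_le_mul_sub_of_hasDerivAt_le {C t : ℝ} (hv : ∀ s, T ≤ s → HasDerivAt v (v' s) s)
    (hC : ∀ s, T ≤ s → v' s ≤ C) (ht : T ≤ t) : v t - v T ≤ C * (t - T) := by
  refine (convex_Ici T).image_sub_le_mul_sub_of_deriv_le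
    (fun s hs => (hv s hs).continuousAt.continuousWithinAt)
    (fun s hs => (hv s (interior_subset hs)).differentiableAt.differentiableWithinAt)
    (fun s hs => ?_) T self_mem_Ici t ht ht
  rw [(hv s (interior_subset hs)).deriv]
  exact hC s (interior_subset hs)

lemma nonpos_of_hasDerivAt_neg_of_eq_zero {t : ℝ} (hv : ∀ s, T ≤ s → HasDerivAt v (v' s) s)
    (hneg : ∀ s, T ≤ s → v s = 0 → v' s < 0) (hT : v T ≤ 0) (ht : T ≤ t) : v t ≤ 0 :=
  image_le_of_deriv_right_lt_deriv_boundary (b := t)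
    (fun s hs => (hv s hs.1).continuousAt.continuousWithinAt)
    (fun s hs => (hv s hs.1).hasDerivWithinAt) hT (fun s => hasDerivAt_const s 0)
    (fun s hs => hneg s hs.1) ⟨ht, le_rfl⟩

lemma eventually_nonpos_of_deriv_le {η : ℝ} (hη : 0 < η)
    (hv : ∀ᶠ t in atTop, HasDerivAt v (v' t) t)
    (hneg : ∀ᶠ t in atTop, 0 ≤ v t → v' t ≤ -η) : ∀ᶠ t in atTop, v t ≤ 0 := by
  obtain ⟨T, hT⟩ := eventually_atTop.1 (hv.and hneg)
  obtain ⟨t₁, ht₁, hvt₁⟩ : ∃ t₁, T ≤ t₁ ∧ v t₁ ≤ 0 := by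
    by_contra! hpos
    have hs : T ≤ T + v T / η := le_add_of_nonneg_right (div_nonneg (hpos T le_rfl).le hη.le)
    have hdecay := sub_le_mul_sub_of_hasDerivAt_le (fun s hs => (hT s hs).1)
      (fun s hs => (hT s hs).2 (hpos s hs).le) hs
    have hdrop : -η * (T + v T / η - T) = -v T := by field_simp; ring
    linarith [hpos _ hs]
  filter_upwards [eventually_ge_atTop t₁] with t ht
  exact nonpos_of_hasDerivAt_neg_of_eq_zero (fun s hs => (hT s (ht₁.trans hs)).1)
    (fun s hs h0 => ((hT s (ht₁.trans hs)).2 h0.ge).trans_lt (neg_neg_of_pos hη)) hvt₁ ht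

lemma eventually_le_mul_of_deriv_le {c η : ℝ} (hη : 0 < η)
    (hv : ∀ᶠ t in atTop, HasDerivAt v (v' t) t)
    (h : ∀ᶠ t in atTop, c * t ≤ v t → v' t ≤ c - η) : ∀ᶠ t in atTop, v t ≤ c * t := by
  have hsub : ∀ᶠ t in atTop, v t - c * t ≤ 0 := by
    refine eventually_nonpos_of_deriv_le hη
      (hv.mono fun t ht => ht.sub (hasDerivAt_const_mul c)) (h.mono fun t ht h0 => ?_)
    linarith [ht (sub_nonneg.1 h0)]
  exact hsub.mono fun t => sub_nonpos.1

lemma eventually_mul_le_of_le_deriv {c η : ℝ} (hη : 0 < η)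
    (hv : ∀ᶠ t in atTop, HasDerivAt v (v' t) t)
    (h : ∀ᶠ t in atTop, v t ≤ c * t → c + η ≤ v' t) : ∀ᶠ t in atTop, c * t ≤ v t := by
  have hneg : ∀ᶠ t in atTop, -v t ≤ -c * t := by
    refine eventually_le_mul_of_deriv_le hη (hv.mono fun t ht => ht.neg)
      (h.mono fun t ht hle => ?_)
    linarith [ht (by linarith)]
  exact hneg.mono fun t ht => by linarith

/-- `x + y` is bounded above, so as long as it exceeds a given positive level, `x` stays in a
compact subset of `(0, ∞)`, on which `f` is bounded below by a positive constant. -/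
lemma tendsto_zero_of_deriv_add_le {f x y w' : ℝ → ℝ} (hfc : ContinuousOn f (Ioi 0))
    (hf : ∀ u, 0 < u → 0 < f u) (hx : ∀ᶠ t in atTop, 0 < x t) (hy : Tendsto y atTop (𝓝 0))
    (hw : ∀ᶠ t in atTop, HasDerivAt (fun s => x s + y s) (w' t) t)
    (hw' : ∀ᶠ t in atTop, w' t ≤ -f (x t)) : Tendsto x atTop (𝓝 0) := by
  refine tendsto_order.2 ⟨fun m hm => hx.mono fun t ht => hm.trans ht, fun m hm => ?_⟩
  have hm3 : 0 < m / 3 := by positivity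
  have hy3 : ∀ᶠ t in atTop, |y t| < m / 3 := by
    simpa using hy.abs.eventually_lt_const (by simpa using hm3)
  obtain ⟨T, hT⟩ := eventually_atTop.1 (hx.and (hw.and hw'))
  set K := x T + y T
  have hbdd : ∀ t, T ≤ t → x t + y t ≤ K := fun t ht => by
    have hle := sub_le_mul_sub_of_hasDerivAt_le (C := 0) (fun s hs => (hT s hs).2.1)
      (fun s hs => (hT s hs).2.2.trans (neg_nonpos.2 (hf _ (hT s hs).1).le)) ht
    linarith
  obtain ⟨η, hη, hfη⟩ : ∃ η, 0 < η ∧ ∀ u ∈ Icc (m / 3) (K + m / 3), η ≤ f u :=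
    isCompact_Icc.exists_forall_le' (hfc.mono fun u hu => hm3.trans_le hu.1)
      fun u hu => hf u (hm3.trans_le hu.1)
  have hlevel : ∀ᶠ t in atTop, x t + y t - 2 * m / 3 ≤ 0 := by
    refine eventually_nonpos_of_deriv_le hη (hw.mono fun t ht => ht.sub_const _) ?_
    filter_upwards [hw', hy3, eventually_ge_atTop T] with t hwt hyt hTt hge
    obtain ⟨hlo, hhi⟩ := abs_lt.1 hyt
    linarith [hfη (x t) ⟨by linarith, by linarith [hbdd t hTt]⟩]
  filter_upwards [hlevel, hy3] with t ht hyt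
  linarith [(abs_lt.1 hyt).1]

end DifferentialInequality

/-! ### L'Hôpital's rule for a denominator tending to infinity -/

section LHopital

variable {p q p' q' : ℝ → ℝ} {a K : ℝ}

lemma eventually_div_lt_of_tendsto_deriv_div {M : ℝ}
    (hp : ∀ᶠ u in 𝓝[>] a, HasDerivAt p (p' u) u) (hq : ∀ᶠ u in 𝓝[>] a, HasDerivAt q (q' u) u)
    (hq' : ∀ᶠ u in 𝓝[>] a, q' u < 0) (hq_top : Tendsto q (𝓝[>] a) atTop)
    (h : Tendsto (fun u => p' u / q' u) (𝓝[>] a) (𝓝 K)) (hM : K < M) :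
    ∀ᶠ u in 𝓝[>] a, p u / q u < M := by
  obtain ⟨N, hKN, hNM⟩ := exists_between hM
  have hderiv : ∀ᶠ u in 𝓝[>] a,
      HasDerivAt (fun s => p s - N * q s) (p' u - N * q' u) u ∧ 0 ≤ p' u - N * q' u := by
    filter_upwards [hp, hq, hq', h.eventually_lt_const hKN] with u hpu hqu hneg hlt
    rw [div_lt_iff_of_neg hneg] at hlt
    exact ⟨hpu.sub (hqu.const_mul N), sub_nonneg.2 hlt.le⟩
  obtain ⟨r, hr, hderiv⟩ := mem_nhdsGT_iff_exists_Ioo_subset.1 hderiv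
  have hmono : MonotoneOn (fun u => p u - N * q u) (Ioo a r) :=
    monotoneOn_of_hasDerivWithinAt_nonneg (convex_Ioo a r)
      (fun u hu => (hderiv hu).1.continuousAt.continuousWithinAt)
      (fun u hu => (hderiv (interior_subset hu)).1.hasDerivWithinAt)
      (fun u hu => (hderiv (interior_subset hu)).2)
  obtain ⟨s, hs⟩ : (Ioo a r).Nonempty := nonempty_Ioo.2 hr
  filter_upwards [Ioo_mem_nhdsGT hs.1, hq_top.eventually_gt_atTop 0,
    (hq_top.const_mul_atTop (sub_pos.2 hNM)).eventually_gt_atTop (p s - N * q s)]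
    with u hu hqu hlarge
  have hle : p u - N * q u ≤ p s - N * q s := hmono ⟨hu.1, hu.2.trans hs.2⟩ hs hu.2.le
  rw [div_lt_iff₀ hqu]
  linarith

lemma tendsto_div_of_tendsto_deriv_div (hp : ∀ᶠ u in 𝓝[>] a, HasDerivAt p (p' u) u)
    (hq : ∀ᶠ u in 𝓝[>] a, HasDerivAt q (q' u) u) (hq' : ∀ᶠ u in 𝓝[>] a, q' u < 0)
    (hq_top : Tendsto q (𝓝[>] a) atTop)
    (h : Tendsto (fun u => p' u / q' u) (𝓝[>] a) (𝓝 K)) :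
    Tendsto (fun u => p u / q u) (𝓝[>] a) (𝓝 K) := by
  refine tendsto_order.2 ⟨fun M hM => ?_,
    fun M hM => eventually_div_lt_of_tendsto_deriv_div hp hq hq' hq_top h hM⟩
  have hneg : ∀ᶠ u in 𝓝[>] a, -p u / q u < -M :=
    eventually_div_lt_of_tendsto_deriv_div (hp.mono fun u hu => hu.neg) hq hq' hq_top
      (by simpa only [neg_div] using h.neg) (neg_lt_neg hM)
  filter_upwards [hneg] with u hu
  rwa [neg_div, neg_lt_neg_iff] at hu

end LHopital

/-! ### Almost monotone and regularly varying functions -/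

/-- `f` is increasing along the filter `l` up to factors arbitrarily close to `1`. It is used
in place of monotonicity for functions that are only asymptotic to an increasing one. -/
def AlmostMonotone (f : ℝ → ℝ) (l : Filter ℝ) : Prop :=
  ∀ C > 1, ∀ᶠ p in l ×ˢ l, p.1 ≤ p.2 → f p.1 ≤ C * f p.2

/-- `f` is regularly varying along the filter `l` (in practice `𝓝[>] 0` or `atTop`) with index `ρ`.
Unlike `RVZero` and `RVInfty`, this asks for neither measurability nor positivity. -/
def RegularlyVarying (f : ℝ → ℝ) (l : Filter ℝ) (ρ : ℝ) : Prop :=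
  ∀ c, 0 < c → Tendsto (fun u => f (c * u) / f u) l (𝓝 (c ^ ρ))

section RegularVariation

variable {ι : Type*} {f φ : ℝ → ℝ} {l : Filter ℝ} {l' : Filter ι} {u v : ι → ℝ} {c d K M ρ : ℝ}

lemma AlmostMonotone.of_tendsto_div_monotoneOn {s : Set ℝ} (hs : s ∈ l) (hφ : MonotoneOn φ s)
    (hf : ∀ᶠ u in l, 0 < f u) (hfφ : Tendsto (fun u => f u / φ u) l (𝓝 1)) :
    AlmostMonotone f l := by
  intro C hC
  have hratio : Tendsto (fun p : ℝ × ℝ => f p.1 / φ p.1 / (f p.2 / φ p.2)) (l ×ˢ l) (𝓝 1) := by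
    rw [← div_one (1 : ℝ)]
    exact (hfφ.comp tendsto_fst).div (hfφ.comp tendsto_snd) one_ne_zero
  have hgood : ∀ᶠ u in l, u ∈ s ∧ 0 < f u ∧ 0 < φ u := by
    filter_upwards [hs, hf, hfφ.eventually_const_lt one_pos] with u hus hfu hdiv
    exact ⟨hus, hfu, (div_pos_iff_of_pos_left hfu).1 hdiv⟩
  filter_upwards [hratio.eventually_lt_const hC, hgood.prod_mk hgood]
    with ⟨u, v⟩ hlt ⟨⟨hus, _, hφu⟩, ⟨hvs, hfv, hφv⟩⟩ huv
  have hle : f u / φ u < C * (f v / φ v) := (div_lt_iff₀ (div_pos hfv hφv)).1 hlt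
  calc f u = f u / φ u * φ u := (div_mul_cancel₀ _ hφu.ne').symm
    _ ≤ C * (f v / φ v) * φ u := by gcongr
    _ ≤ C * (f v / φ v) * φ v := by gcongr; exact hφ hus hvs huv
    _ = C * f v := by rw [mul_assoc, div_mul_cancel₀ _ hφv.ne']

lemma AlmostMonotone.inv_comp_antitoneOn {y : ℝ → ℝ} {m : Filter ℝ} {s : Set ℝ}
    (hmono : AlmostMonotone f l) (hf : ∀ᶠ u in l, 0 < f u) (hy : Tendsto y m l) (hs : s ∈ m)
    (hanti : AntitoneOn y s) : AlmostMonotone (fun t => (f (y t))⁻¹) m := by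
  intro C hC
  have hswap : Tendsto (fun p : ℝ × ℝ => (y p.2, y p.1)) (m ×ˢ m) (l ×ˢ l) :=
    (hy.comp tendsto_snd).prodMk (hy.comp tendsto_fst)
  have hgood : ∀ᶠ t in m, 0 < f (y t) ∧ t ∈ s := (hy.eventually hf).and hs
  filter_upwards [hswap.eventually (hmono C hC), hgood.prod_mk hgood]
    with ⟨t, r⟩ hle ⟨⟨hft, hts⟩, ⟨hfr, hrs⟩⟩ htr
  rw [← div_eq_mul_inv, inv_le_iff_one_le_mul₀ hft, div_mul_eq_mul_div, one_le_div hfr]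
  exact hle (hanti hts hrs htr)

lemma RegularlyVarying.inv (hrv : RegularlyVarying f l ρ) :
    RegularlyVarying (fun u => (f u)⁻¹) l (-ρ) := by
  intro c hc
  have h := (hrv c hc).inv₀ (Real.rpow_pos_of_pos hc ρ).ne'
  rw [← Real.rpow_neg hc.le] at h
  simpa only [inv_div, inv_div_inv] using h

lemma AlmostMonotone.eventually_div_lt (hmono : AlmostMonotone f l) (hf : ∀ᶠ u in l, 0 < f u)
    (hd : Tendsto (fun u => f (d * u) / f u) l (𝓝 K)) (hu : Tendsto u l' l)
    (hdu : Tendsto (fun i => d * u i) l' l) (hv : Tendsto v l' l) (hKM : K < M) :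
    ∀ᶠ i in l', v i ≤ d * u i → f (v i) / f (u i) < M := by
  obtain ⟨C, hCM, hC⟩ : ∃ C, C * K < M ∧ 1 < C := by
    have hcont : Tendsto (fun C : ℝ => C * K) (𝓝[>] 1) (𝓝 (1 * K)) :=
      (continuous_mul_const K).continuousWithinAt
    exact ((hcont.eventually_lt_const (by rwa [one_mul])).and self_mem_nhdsWithin).exists
  filter_upwards [(hv.prodMk hdu).eventually (hmono C hC), hu.eventually hf,
    ((hd.comp hu).const_mul C).eventually_lt_const hCM] with i hle hfu hlt hvd
  calc f (v i) / f (u i) ≤ C * f (d * u i) / f (u i) := by gcongr; exact hle hvd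
    _ = C * (f (d * u i) / f (u i)) := mul_div_assoc _ _ _
    _ < M := hlt

lemma AlmostMonotone.eventually_lt_div (hmono : AlmostMonotone f l) (hf : ∀ᶠ u in l, 0 < f u)
    (hd : Tendsto (fun u => f (d * u) / f u) l (𝓝 K)) (hu : Tendsto u l' l)
    (hdu : Tendsto (fun i => d * u i) l' l) (hv : Tendsto v l' l) (hMK : M < K) :
    ∀ᶠ i in l', d * u i ≤ v i → M < f (v i) / f (u i) := by
  obtain ⟨C, hCM, hC⟩ : ∃ C, C * M < K ∧ 1 < C := by
    have hcont : Tendsto (fun C : ℝ => C * M) (𝓝[>] 1) (𝓝 (1 * M)) :=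
      (continuous_mul_const M).continuousWithinAt
    exact ((hcont.eventually_lt_const (by rwa [one_mul])).and self_mem_nhdsWithin).exists
  filter_upwards [(hdu.prodMk hv).eventually (hmono C hC), hu.eventually hf,
    (hd.comp hu).eventually_const_lt hCM] with i hle hfu hlt hdv
  refine lt_of_mul_lt_mul_left ?_ (zero_le_one.trans hC.le)
  calc C * M < f (d * u i) / f (u i) := hlt
    _ ≤ C * f (v i) / f (u i) := by gcongr; exact hle hdv
    _ = C * (f (v i) / f (u i)) := mul_div_assoc _ _ _

lemma RegularlyVarying.tendsto_div_of_tendsto_div (hrv : RegularlyVarying f l ρ)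
    (hmono : AlmostMonotone f l) (hf : ∀ᶠ u in l, 0 < f u)
    (hl : ∀ d, 0 < d → Tendsto (fun u => d * u) l l) (hu : Tendsto u l' l) (hv : Tendsto v l' l)
    (hu_pos : ∀ᶠ i in l', 0 < u i) (hc : 0 < c)
    (huv : Tendsto (fun i => v i / u i) l' (𝓝 c)) :
    Tendsto (fun i => f (v i) / f (u i)) l' (𝓝 (c ^ ρ)) := by
  have hcont : Tendsto (fun d : ℝ => d ^ ρ) (𝓝 c) (𝓝 (c ^ ρ)) :=
    Real.continuousAt_rpow_const c ρ (Or.inl hc.ne')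
  refine tendsto_order.2 ⟨fun M hM => ?_, fun M hM => ?_⟩
  · obtain ⟨d, ⟨hMd, hd⟩, hdc⟩ : ∃ d, (M < d ^ ρ ∧ 0 < d) ∧ d < c :=
      (((hcont.eventually_const_lt hM).and (lt_mem_nhds hc)).filter_mono
        nhdsWithin_le_nhds |>.and (self_mem_nhdsWithin (s := Iio c))).exists
    filter_upwards [hmono.eventually_lt_div hf (hrv d hd) hu ((hl d hd).comp hu) hv hMd, hu_pos,
      huv.eventually_const_lt hdc] with i himp hui hlt
    exact himp ((lt_div_iff₀ hui).1 hlt).le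
  · obtain ⟨d, hdM, hcd⟩ : ∃ d, d ^ ρ < M ∧ c < d :=
      ((hcont.eventually_lt_const hM).filter_mono
        nhdsWithin_le_nhds |>.and (self_mem_nhdsWithin (s := Ioi c))).exists
    have hd : 0 < d := hc.trans hcd
    filter_upwards [hmono.eventually_div_lt hf (hrv d hd) hu ((hl d hd).comp hu) hv hdM, hu_pos,
      huv.eventually_lt_const hcd] with i himp hui hlt
    exact himp ((div_lt_iff₀ hui).1 hlt).le

lemma tendsto_const_mul_nhdsGT_zero (hc : 0 < c) :
    Tendsto (fun u => c * u) (𝓝[>] 0) (𝓝[>] 0) :=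
  fun _ hs => eventually_nhdsGT_zero_mul_left hc hs

end RegularVariation

/-! ### The scalar equation `z' = 1 - b(t) h(z) / h(t)` -/

section LimitingSlope

variable {h b z : ℝ → ℝ} {L c γ Λ : ℝ}

lemma strictMonoOn_add_mul_rpow (hL : 0 < L) (hγ : 0 < γ) :
    StrictMonoOn (fun Λ : ℝ => Λ + L * Λ ^ γ) (Ici 0) :=
  fun _ ha _ _ hab => add_lt_add hab (mul_lt_mul_of_pos_left (Real.rpow_lt_rpow ha hab hγ) hL)

lemma one_sub_mul_rpow_neg_eq_iff (hΛ : 0 < Λ) :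
    (1 - Λ) * Λ ^ (-γ) = L ↔ Λ + L * Λ ^ γ = 1 := by
  rw [Real.rpow_neg hΛ.le, ← div_eq_mul_inv, div_eq_iff (Real.rpow_pos_of_pos hΛ γ).ne',
    sub_eq_iff_eq_add', eq_comm]

lemma exists_one_sub_mul_rpow_neg_eq (hL : 0 < L) (hγ : 0 < γ) :
    ∃ Λ ∈ Ioo (0 : ℝ) 1, (1 - Λ) * Λ ^ (-γ) = L ∧
      ∀ Λ' : ℝ, 0 < Λ' → (1 - Λ') * Λ' ^ (-γ) = L → Λ' = Λ := by
  have hcont : Continuous fun Λ : ℝ => Λ + L * Λ ^ γ :=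
    continuous_id.add (continuous_const.mul (Real.continuous_rpow_const hγ.le))
  obtain ⟨Λ, hΛ, hΛL⟩ : ∃ Λ ∈ Ioo (0 : ℝ) 1, Λ + L * Λ ^ γ = 1 :=
    intermediate_value_Ioo zero_le_one hcont.continuousOn
      ⟨by simp [Real.zero_rpow hγ.ne'], by simpa using hL⟩
  refine ⟨Λ, hΛ, (one_sub_mul_rpow_neg_eq_iff hΛ.1).2 hΛL, fun Λ' hΛ' h => ?_⟩
  exact (strictMonoOn_add_mul_rpow hL hγ).injOn hΛ'.le hΛ.1.le
    (((one_sub_mul_rpow_neg_eq_iff hΛ').1 h).trans hΛL.symm)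

lemma eventually_mul_le_of_mul_rpow_lt (hL : 0 < L) (hc : 0 < c) (hcL : L * c ^ γ < 1 - c)
    (hh : ∀ᶠ t in atTop, 0 < h t) (hmono : AlmostMonotone h atTop)
    (hrv : RegularlyVarying h atTop γ) (hb : Tendsto b atTop (𝓝 L)) (hz_top : Tendsto z atTop atTop)
    (hz : ∀ᶠ t in atTop, HasDerivAt z (1 - b t * (h (z t) / h t)) t) :
    ∀ᶠ t in atTop, c * t ≤ z t := by
  obtain ⟨M, hcM, hM⟩ := exists_between ((lt_div_iff₀' hL).2 hcL)
  obtain ⟨K, hLM, hK⟩ := exists_between ((lt_div_iff₀' hL).1 hM)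
  refine eventually_mul_le_of_le_deriv (sub_pos.2 hK) hz ?_
  filter_upwards [hmono.eventually_div_lt hh (hrv c hc) tendsto_id (tendsto_id.const_mul_atTop hc)
      hz_top hcM, hb.eventually_const_lt hL, (hb.mul_const M).eventually_lt_const hLM]
    with t hratio hbt hbM hzt
  have hlt : b t * (h (z t) / h t) < b t * M := mul_lt_mul_of_pos_left (hratio hzt) hbt
  linarith

lemma eventually_le_mul_of_lt_mul_rpow (hL : 0 < L) (hc : 0 < c) (hcL : 1 - c < L * c ^ γ)
    (hh : ∀ᶠ t in atTop, 0 < h t) (hmono : AlmostMonotone h atTop)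
    (hrv : RegularlyVarying h atTop γ) (hb : Tendsto b atTop (𝓝 L)) (hz_top : Tendsto z atTop atTop)
    (hz : ∀ᶠ t in atTop, HasDerivAt z (1 - b t * (h (z t) / h t)) t) :
    ∀ᶠ t in atTop, z t ≤ c * t := by
  obtain ⟨M, hM, hMc⟩ := exists_between ((div_lt_iff₀' hL).2 hcL)
  obtain ⟨K, hK, hLM⟩ := exists_between ((div_lt_iff₀' hL).1 hM)
  refine eventually_le_mul_of_deriv_le (sub_pos.2 hK) hz ?_
  filter_upwards [hmono.eventually_lt_div hh (hrv c hc) tendsto_id (tendsto_id.const_mul_atTop hc)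
      hz_top hMc, hb.eventually_const_lt hL, (hb.mul_const M).eventually_const_lt hLM]
    with t hratio hbt hbM hzt
  have hlt : b t * M < b t * (h (z t) / h t) := mul_lt_mul_of_pos_left (hratio hzt) hbt
  linarith

theorem tendsto_div_of_hasDerivAt_one_sub (hγ : 0 < γ) (hL : 0 < L) (hΛ : 0 < Λ)
    (hΛL : Λ + L * Λ ^ γ = 1) (hh : ∀ᶠ t in atTop, 0 < h t) (hmono : AlmostMonotone h atTop)
    (hrv : RegularlyVarying h atTop γ) (hb : Tendsto b atTop (𝓝 L)) (hz_top : Tendsto z atTop atTop)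
    (hz : ∀ᶠ t in atTop, HasDerivAt z (1 - b t * (h (z t) / h t)) t) :
    Tendsto (fun t => z t / t) atTop (𝓝 Λ) := by
  have hbalance := strictMonoOn_add_mul_rpow hL hγ
  refine tendsto_order.2 ⟨fun m hm => ?_, fun m hm => ?_⟩
  · obtain ⟨c, hmc, hcΛ⟩ := exists_between (max_lt hm hΛ)
    obtain ⟨hmc, hc⟩ := max_lt_iff.1 hmc
    have hcL : c + L * c ^ γ < 1 := hΛL ▸ hbalance hc.le hΛ.le hcΛ
    filter_upwards [eventually_mul_le_of_mul_rpow_lt hL hc (lt_sub_iff_add_lt'.2 hcL) hh hmono hrv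
      hb hz_top hz, eventually_gt_atTop 0] with t ht htpos
    exact hmc.trans_le ((le_div_iff₀ htpos).2 ht)
  · obtain ⟨c, hΛc, hcm⟩ := exists_between hm
    have hc : 0 < c := hΛ.trans hΛc
    have hcL : 1 < c + L * c ^ γ := hΛL ▸ hbalance hΛ.le hc.le hΛc
    filter_upwards [eventually_le_mul_of_lt_mul_rpow hL hc (sub_lt_iff_lt_add'.2 hcL) hh hmono hrv
      hb hz_top hz, eventually_gt_atTop 0] with t ht htpos
    exact ((div_le_iff₀ htpos).2 ht).trans_lt hcm

end LimitingSlope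

/-! ### The functions `F` and `F⁻¹` -/

section InverseFunction

variable {f : ℝ → ℝ} {t u β ρ : ℝ}

lemma hasStrictDerivAt_F (hfc : ContinuousOn f (Ioi 0)) (hf : ∀ u, 0 < u → 0 < f u) (hu : 0 < u) :
    HasStrictDerivAt (F f) (-(1 / f u)) u := by
  have hc : ContinuousOn (fun v => 1 / f v) (Ioi 0) :=
    continuousOn_const.div hfc fun v hv => (hf v hv).ne'
  exact intervalIntegral.integral_hasStrictDerivAt_left
    (ContinuousOn.intervalIntegrable (hc.mono fun v hv => (lt_min hu one_pos).trans_le hv.1))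
    (hc.stronglyMeasurableAtFilter isOpen_Ioi u hu) (hc.continuousAt (Ioi_mem_nhds hu))

lemma continuousOn_F (hfc : ContinuousOn f (Ioi 0)) (hf : ∀ u, 0 < u → 0 < f u) :
    ContinuousOn (F f) (Ioi 0) :=
  fun _ hu => (hasStrictDerivAt_F hfc hf hu).hasDerivAt.continuousAt.continuousWithinAt

lemma strictAntiOn_F (hfc : ContinuousOn f (Ioi 0)) (hf : ∀ u, 0 < u → 0 < f u) :
    StrictAntiOn (F f) (Ioi 0) := by
  refine strictAntiOn_of_deriv_neg (convex_Ioi 0) (continuousOn_F hfc hf) fun u hu => ?_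
  have hu : 0 < u := interior_subset hu
  rw [(hasStrictDerivAt_F hfc hf hu).hasDerivAt.deriv]
  exact neg_neg_of_pos (one_div_pos.2 (hf u hu))

lemma surjOn_F (hfc : ContinuousOn f (Ioi 0)) (hf : ∀ u, 0 < u → 0 < f u)
    (hF : Tendsto (F f) (𝓝[>] 0) atTop) : SurjOn (F f) (Ioi 0) (Ici 0) := by
  intro t ht
  obtain ⟨u, htu, hu⟩ := ((hF.eventually_ge_atTop t).and
    (Ioo_mem_nhdsGT (zero_lt_one' ℝ))).exists
  have hsub : Icc u 1 ⊆ Ioi 0 := fun v hv => hu.1.trans_le hv.1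
  have hF1 : F f 1 ≤ t := by simpa [F] using ht
  exact image_mono hsub
    (intermediate_value_Icc' hu.2.le ((continuousOn_F hfc hf).mono hsub) ⟨hF1, htu⟩)

lemma Finv_F (hfc : ContinuousOn f (Ioi 0)) (hf : ∀ u, 0 < u → 0 < f u) (hu : 0 < u) :
    Finv f (F f u) = u :=
  (strictAntiOn_F hfc hf).injOn.leftInvOn_invFunOn hu

lemma F_Finv (hfc : ContinuousOn f (Ioi 0)) (hf : ∀ u, 0 < u → 0 < f u)
    (hF : Tendsto (F f) (𝓝[>] 0) atTop) (ht : 0 ≤ t) : F f (Finv f t) = t :=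
  (surjOn_F hfc hf hF).rightInvOn_invFunOn ht

lemma Finv_pos (hfc : ContinuousOn f (Ioi 0)) (hf : ∀ u, 0 < u → 0 < f u)
    (hF : Tendsto (F f) (𝓝[>] 0) atTop) (ht : 0 ≤ t) : 0 < Finv f t :=
  (surjOn_F hfc hf hF).mapsTo_invFunOn ht

lemma Finv_lt_iff (hfc : ContinuousOn f (Ioi 0)) (hf : ∀ u, 0 < u → 0 < f u)
    (hF : Tendsto (F f) (𝓝[>] 0) atTop) (ht : 0 ≤ t) (hu : 0 < u) :
    Finv f t < u ↔ F f u < t := by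
  rw [← (strictAntiOn_F hfc hf).lt_iff_gt hu (Finv_pos hfc hf hF ht), F_Finv hfc hf hF ht]

lemma lt_Finv_iff (hfc : ContinuousOn f (Ioi 0)) (hf : ∀ u, 0 < u → 0 < f u)
    (hF : Tendsto (F f) (𝓝[>] 0) atTop) (ht : 0 ≤ t) (hu : 0 < u) :
    u < Finv f t ↔ t < F f u := by
  rw [← (strictAntiOn_F hfc hf).lt_iff_gt (Finv_pos hfc hf hF ht) hu, F_Finv hfc hf hF ht]

lemma antitoneOn_Finv (hfc : ContinuousOn f (Ioi 0)) (hf : ∀ u, 0 < u → 0 < f u)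
    (hF : Tendsto (F f) (𝓝[>] 0) atTop) : AntitoneOn (Finv f) (Ici 0) := by
  intro s hs t ht hst
  rw [← not_lt, lt_Finv_iff hfc hf hF ht (Finv_pos hfc hf hF hs), F_Finv hfc hf hF hs]
  exact not_lt.2 hst

lemma tendsto_Finv (hfc : ContinuousOn f (Ioi 0)) (hf : ∀ u, 0 < u → 0 < f u)
    (hF : Tendsto (F f) (𝓝[>] 0) atTop) : Tendsto (Finv f) atTop (𝓝[>] 0) := by
  have hpos : ∀ᶠ t in atTop, 0 < Finv f t :=
    (eventually_ge_atTop 0).mono fun t ht => Finv_pos hfc hf hF ht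
  refine tendsto_nhdsWithin_iff.2 ⟨tendsto_order.2 ⟨fun m hm => ?_, fun m hm => ?_⟩, hpos⟩
  · exact hpos.mono fun t ht => hm.trans ht
  · filter_upwards [eventually_ge_atTop 0, eventually_gt_atTop (F f m)] with t ht htm
    exact (Finv_lt_iff hfc hf hF ht hm).2 htm

lemma hasDerivAt_Finv (hfc : ContinuousOn f (Ioi 0)) (hf : ∀ u, 0 < u → 0 < f u)
    (hF : Tendsto (F f) (𝓝[>] 0) atTop) (ht : 0 ≤ t) :
    HasDerivAt (Finv f) (-f (Finv f t)) t := by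
  have hpos := Finv_pos hfc hf hF ht
  have h := (hasStrictDerivAt_F hfc hf hpos).to_local_left_inverse
    (neg_ne_zero.2 (one_div_ne_zero (hf _ hpos).ne')) (g := Finv f)
    ((eventually_gt_nhds hpos).mono fun u hu => Finv_F hfc hf hu)
  simpa [F_Finv hfc hf hF ht] using h.hasDerivAt

lemma regularlyVarying_F (hrv : RegularlyVarying f (𝓝[>] 0) β) (hfc : ContinuousOn f (Ioi 0))
    (hf : ∀ u, 0 < u → 0 < f u) (hF : Tendsto (F f) (𝓝[>] 0) atTop) :
    RegularlyVarying (F f) (𝓝[>] 0) (1 - β) := by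
  intro c hc
  have hpos : ∀ᶠ u : ℝ in 𝓝[>] 0, 0 < u := self_mem_nhdsWithin
  have hderiv : ∀ᶠ u in 𝓝[>] 0,
      HasDerivAt (fun u => F f (c * u)) (-(1 / f (c * u)) * c) u :=
    hpos.mono fun u hu => (hasStrictDerivAt_F hfc hf (mul_pos hc hu)).hasDerivAt.comp u
      (hasDerivAt_const_mul c)
  refine tendsto_div_of_tendsto_deriv_div hderiv
    (hpos.mono fun u hu => (hasStrictDerivAt_F hfc hf hu).hasDerivAt)
    (hpos.mono fun u hu => neg_neg_of_pos (one_div_pos.2 (hf u hu))) hF ?_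
  have hlim := ((hrv c hc).inv₀ (Real.rpow_pos_of_pos hc β).ne').const_mul c
  rw [show c * (c ^ β)⁻¹ = c ^ (1 - β) by rw [Real.rpow_sub hc, Real.rpow_one, div_eq_mul_inv]]
    at hlim
  refine hlim.congr' (hpos.mono fun u hu => ?_)
  have hfu := (hf u hu).ne'
  have hfcu := (hf (c * u) (mul_pos hc hu)).ne'
  field_simp

lemma regularlyVarying_Finv (hrv : RegularlyVarying (F f) (𝓝[>] 0) ρ) (hρ : ρ < 0)
    (hfc : ContinuousOn f (Ioi 0)) (hf : ∀ u, 0 < u → 0 < f u)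
    (hF : Tendsto (F f) (𝓝[>] 0) atTop) : RegularlyVarying (Finv f) atTop ρ⁻¹ := by
  intro c hc
  have hlim : ∀ d, 0 < d →
      Tendsto (fun t => F f (d * Finv f t) / t) atTop (𝓝 (d ^ ρ)) := by
    refine fun d hd => ((hrv d hd).comp (tendsto_Finv hfc hf hF)).congr' ?_
    filter_upwards [eventually_ge_atTop 0] with t ht
    simp only [Function.comp_apply, F_Finv hfc hf hF ht]
  have hroot : 0 < c ^ ρ⁻¹ := Real.rpow_pos_of_pos hc _
  have hpow : (c ^ ρ⁻¹) ^ ρ = c := Real.rpow_inv_rpow hc.le hρ.ne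
  refine tendsto_order.2 ⟨fun m hm => ?_, fun m hm => ?_⟩
  · obtain ⟨d, hmd, hdc⟩ := exists_between (max_lt hm hroot)
    obtain ⟨hmd, hd⟩ := max_lt_iff.1 hmd
    have hcd : c < d ^ ρ := hpow ▸ Real.rpow_lt_rpow_of_neg hd hdc hρ
    filter_upwards [(hlim d hd).eventually_const_lt hcd, eventually_gt_atTop 0] with t hlt ht
    have hy := Finv_pos hfc hf hF ht.le
    refine hmd.trans ((lt_div_iff₀ hy).2 ?_)
    exact (lt_Finv_iff hfc hf hF (mul_pos hc ht).le (mul_pos hd hy)).2 ((lt_div_iff₀ ht).1 hlt)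
  · have hmpos : 0 < m := hroot.trans hm
    have hmc : m ^ ρ < c := hpow ▸ Real.rpow_lt_rpow_of_neg hroot hm hρ
    filter_upwards [(hlim m hmpos).eventually_lt_const hmc, eventually_gt_atTop 0] with t hlt ht
    have hy := Finv_pos hfc hf hF ht.le
    rw [div_lt_iff₀ hy, Finv_lt_iff hfc hf hF (mul_pos hc ht).le (mul_pos hmpos hy)]
    exact (div_lt_iff₀ ht).1 hlt

lemma regularlyVarying_comp_Finv (hrv : RegularlyVarying f (𝓝[>] 0) β) (hβ : 1 < β)
    (hmono : AlmostMonotone f (𝓝[>] 0)) (hfc : ContinuousOn f (Ioi 0))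
    (hf : ∀ u, 0 < u → 0 < f u) (hF : Tendsto (F f) (𝓝[>] 0) atTop) :
    RegularlyVarying (fun t => f (Finv f t)) atTop (-(β / (β - 1))) := by
  intro c hc
  have hindex : c ^ (-(β / (β - 1))) = (c ^ (1 - β)⁻¹) ^ β := by
    rw [← Real.rpow_mul hc.le, ← neg_sub β 1, inv_neg, neg_mul, inv_mul_eq_div]
  have hFinv := tendsto_Finv hfc hf hF
  rw [hindex]
  exact hrv.tendsto_div_of_tendsto_div hmono (eventually_mem_nhdsWithin.mono hf)
    (fun _ => tendsto_const_mul_nhdsGT_zero) hFinv (hFinv.comp (tendsto_id.const_mul_atTop hc))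
    ((eventually_ge_atTop 0).mono fun t ht => Finv_pos hfc hf hF ht) (Real.rpow_pos_of_pos hc _)
    (regularlyVarying_Finv (regularlyVarying_F hrv hfc hf hF) (sub_neg.2 hβ) hfc hf hF c
      hc)

end InverseFunction

/-! ### Solutions of the perturbed equation -/

section Solution

variable {f g x : ℝ → ℝ} {ξ L t γ Λ : ℝ}

lemma IsSolution.nonneg (hx : IsSolution f g ξ x) (hξ : 0 < ξ) (hf0 : f 0 ≤ 0)
    (hg : ∀ t, 0 < t → 0 < g t) (ht : 0 < t) : 0 ≤ x t := by
  have hstart : ∀ᶠ s in 𝓝[>] 0, 0 < x s :=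
    ((hx.continuousOn 0 self_mem_Ici).mono Ioi_subset_Ici_self).eventually_const_lt
      (hx.initial ▸ hξ)
  obtain ⟨a, hxa, ha⟩ := (hstart.and (Ioo_mem_nhdsGT ht)).exists
  have hneg : -x t ≤ 0 := by
    refine nonpos_of_hasDerivAt_neg_of_eq_zero (v := fun s => -x s) (T := a)
      (fun s hs => (hx.hasDerivAt s (ha.1.trans_le hs)).neg) (fun s hs hxs => ?_)
      (neg_nonpos.2 hxa.le) ha.2.le
    rw [neg_eq_zero.1 hxs]
    linarith [hg s (ha.1.trans_le hs)]
  exact neg_nonpos.1 hneg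

lemma IsSolution.pos (hx : IsSolution f g ξ x) (hξ : 0 < ξ) (hf0 : f 0 ≤ 0)
    (hg : ∀ t, 0 < t → 0 < g t) (ht : 0 < t) : 0 < x t := by
  refine (hx.nonneg hξ hf0 hg ht).lt_of_ne' fun hxt => ?_
  have hmin : IsLocalMin x t := by
    filter_upwards [Ioi_mem_nhds ht] with s hs
    rw [hxt]
    exact hx.nonneg hξ hf0 hg hs
  have hzero := hmin.hasDerivAt_eq_zero (hx.hasDerivAt t ht)
  rw [hxt] at hzero
  linarith [hg t ht]

/-- Since `F⁻¹` solves the unperturbed equation, adding a large multiple of it to `x` absorbs the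
forcing term `g`. -/
lemma IsSolution.tendsto_zero (hx : IsSolution f g ξ x) (hfc : ContinuousOn f (Ioi 0))
    (hf : ∀ u, 0 < u → 0 < f u) (hF : Tendsto (F f) (𝓝[>] 0) atTop)
    (hx_pos : ∀ t, 0 < t → 0 < x t)
    (hgL : Tendsto (fun t => g t / f (Finv f t)) atTop (𝓝 L)) : Tendsto x atTop (𝓝 0) := by
  have hFinv : Tendsto (fun t => (L + 1) * Finv f t) atTop (𝓝 0) := by
    simpa using ((tendsto_Finv hfc hf hF).mono_right nhdsWithin_le_nhds).const_mul (L + 1)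
  have hpos := eventually_gt_atTop (0 : ℝ)
  refine tendsto_zero_of_deriv_add_le hfc hf (hpos.mono hx_pos) hFinv
    (hpos.mono fun t ht =>
      (hx.hasDerivAt t ht).add ((hasDerivAt_Finv hfc hf hF ht.le).const_mul (L + 1))) ?_
  filter_upwards [hpos, hgL.eventually_lt_const (lt_add_one L)] with t ht hlt
  rw [div_lt_iff₀ (hf _ (Finv_pos hfc hf hF ht.le))] at hlt
  linarith

lemma IsSolution.hasDerivAt_F (hx : IsSolution f g ξ x) (hfc : ContinuousOn f (Ioi 0))
    (hf : ∀ u, 0 < u → 0 < f u) (ht : 0 < t) (hxt : 0 < x t) :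
    HasDerivAt (fun s => F f (x s)) (1 - g t / f (x t)) t := by
  have hfx := (hf _ hxt).ne'
  refine ((hasStrictDerivAt_F hfc hf hxt).hasDerivAt.comp t (hx.hasDerivAt t ht)).congr_deriv ?_
  field_simp
  ring

theorem IsSolution.tendsto_F_div (hx : IsSolution f g ξ x) (hfc : ContinuousOn f (Ioi 0))
    (hf : ∀ u, 0 < u → 0 < f u) (hF : Tendsto (F f) (𝓝[>] 0) atTop)
    (hmono : AlmostMonotone f (𝓝[>] 0)) (hx_pos : ∀ t, 0 < t → 0 < x t)
    (hL : 0 < L) (hgL : Tendsto (fun t => g t / f (Finv f t)) atTop (𝓝 L)) (hγ : 0 < γ)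
    (hrv : RegularlyVarying (fun t => f (Finv f t)) atTop (-γ))
    (hΛ : 0 < Λ) (hΛL : (1 - Λ) * Λ ^ (-γ) = L) :
    Tendsto (fun t => F f (x t) / t) atTop (𝓝 Λ) := by
  have hpos := eventually_gt_atTop (0 : ℝ)
  have hFinv := tendsto_Finv hfc hf hF
  have hf_ev : ∀ᶠ u in 𝓝[>] 0, 0 < f u := eventually_mem_nhdsWithin.mono hf
  have hx_zero := hx.tendsto_zero hfc hf hF hx_pos hgL
  refine tendsto_div_of_hasDerivAt_one_sub (h := fun t => (f (Finv f t))⁻¹) hγ hL hΛ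
    ((one_sub_mul_rpow_neg_eq_iff hΛ).1 hΛL)
    ((hFinv.eventually hf_ev).mono fun t => inv_pos.2)
    (hmono.inv_comp_antitoneOn hf_ev hFinv (Ici_mem_atTop 0) (antitoneOn_Finv hfc hf hF))
    (by simpa only [neg_neg] using hrv.inv) hgL
    (hF.comp (tendsto_nhdsWithin_iff.2 ⟨hx_zero, hpos.mono hx_pos⟩))
    (hpos.mono fun t ht => ?_)
  refine (hx.hasDerivAt_F hfc hf ht (hx_pos t ht)).congr_deriv ?_
  have hfy := (hf _ (Finv_pos hfc hf hF ht.le)).ne'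
  rw [Finv_F hfc hf (hx_pos t ht), inv_div_inv, div_mul_div_cancel₀ hfy]

end Solution

end PerturbedODE

theorem mainTheorem3_general (f g : ℝ → ℝ) (ξ : ℝ) (x : ℝ → ℝ) (φ : ℝ → ℝ) (δ L : ℝ)
    (hf_cont : ContinuousOn f (Ioi 0)) (hf_pos : ∀ u, 0 < u → 0 < f u) (hf_zero : f 0 ≤ 0)
    (hF : Tendsto (PerturbedODE.F f) (𝓝[>] 0) atTop)
    (hg_pos : ∀ t, 0 < t → 0 < g t) (hξ : 0 < ξ)
    (hx : PerturbedODE.IsSolution f g ξ x)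
    (hδ : 0 < δ) (hφ_mono : MonotoneOn φ (Ioo 0 δ))
    (hfφ : Tendsto (fun u => f u / φ u) (𝓝[>] 0) (𝓝 1))
    (hL : 0 < L)
    (hgL : Tendsto (fun t => g t / f (PerturbedODE.Finv f t)) atTop (𝓝 L)) :
    Tendsto x atTop (𝓝 0) ∧
    (∀ β : ℝ, 1 < β → PerturbedODE.RegularlyVarying f (𝓝[>] 0) β →
      ∃ Λ ∈ Ioo (0 : ℝ) 1,
        (1 - Λ) * Λ ^ (-(β / (β - 1))) = L ∧
        (∀ Λ' : ℝ, 0 < Λ' → (1 - Λ') * Λ' ^ (-(β / (β - 1))) = L → Λ' = Λ) ∧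
        Tendsto (fun t => PerturbedODE.F f (x t) / t) atTop (𝓝 Λ)) ∧
    (PerturbedODE.RegularlyVarying (fun t => f (PerturbedODE.Finv f t)) atTop (-1) →
      ∃ Λ ∈ Ioo (0 : ℝ) 1,
        (1 - Λ) * Λ⁻¹ = L ∧
        (∀ Λ' : ℝ, 0 < Λ' → (1 - Λ') * Λ'⁻¹ = L → Λ' = Λ) ∧
        Λ = 1 / (L + 1) ∧
        Tendsto (fun t => PerturbedODE.F f (x t) / t) atTop (𝓝 Λ)) := by
  have hmono : PerturbedODE.AlmostMonotone f (𝓝[>] 0) :=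
    .of_tendsto_div_monotoneOn (Ioo_mem_nhdsGT hδ) hφ_mono
      (eventually_mem_nhdsWithin.mono hf_pos) hfφ
  have hx_pos : ∀ t, 0 < t → 0 < x t := fun t => hx.pos hξ hf_zero hg_pos
  refine ⟨hx.tendsto_zero hf_cont hf_pos hF hx_pos hgL, fun β hβ hrv => ?_, fun hrv => ?_⟩
  · have hγ : 0 < β / (β - 1) := div_pos (one_pos.trans hβ) (sub_pos.2 hβ)
    obtain ⟨Λ, hΛ, hΛL, huniq⟩ := PerturbedODE.exists_one_sub_mul_rpow_neg_eq hL hγ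
    exact ⟨Λ, hΛ, hΛL, huniq, hx.tendsto_F_div hf_cont hf_pos hF hmono hx_pos hL hgL hγ
      (PerturbedODE.regularlyVarying_comp_Finv hrv hβ hmono hf_cont hf_pos hF) hΛ.1 hΛL⟩
  · obtain ⟨Λ, hΛ, hΛL, huniq⟩ := PerturbedODE.exists_one_sub_mul_rpow_neg_eq hL one_pos
    have hlim := hx.tendsto_F_div hf_cont hf_pos hF hmono hx_pos hL hgL one_pos hrv hΛ.1 hΛL
    simp only [Real.rpow_neg_one] at hΛL huniq
    have hΛ_eq : Λ = 1 / (L + 1) := by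
      rw [← hΛL, sub_mul, one_mul, mul_inv_cancel₀ hΛ.1.ne', sub_add_cancel, one_div, inv_inv]
    exact ⟨Λ, hΛ, hΛL, huniq, hΛ_eq, hlim⟩

theorem mainTheorem3 (f g : ℝ → ℝ) (ξ : ℝ) (x : ℝ → ℝ) (φ : ℝ → ℝ) (δ L : ℝ)
    (hf_sign : ∀ u, u ≠ 0 → 0 < u * f u) (hf_zero : f 0 = 0)
    (hf_lip : LocallyLipschitz f)
    (hF : Tendsto (PerturbedODE.F f) (𝓝[>] 0) atTop)
    (hg_cont : ContinuousOn g (Ici 0)) (hg_pos : ∀ t, 0 < t → 0 < g t)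
    (hξ : 0 < ξ)
    (hx : PerturbedODE.IsSolution f g ξ x)
    (hδ : 0 < δ) (hφ_mono : MonotoneOn φ (Ioo 0 δ))
    (hfφ : Tendsto (fun u => f u / φ u) (𝓝[>] 0) (𝓝 1))
    (hL : 0 < L)
    (hgL : Tendsto (fun t => g t / f (PerturbedODE.Finv f t)) atTop (𝓝 L)) :
    Tendsto x atTop (𝓝 0) ∧
    (∀ β : ℝ, 1 < β → PerturbedODE.RVZero f β →
      ∃ Λ ∈ Ioo (0 : ℝ) 1,
        (1 - Λ) * Λ ^ (-(β / (β - 1))) = L ∧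
        (∀ Λ' : ℝ, 0 < Λ' → (1 - Λ') * Λ' ^ (-(β / (β - 1))) = L → Λ' = Λ) ∧
        Tendsto (fun t => PerturbedODE.F f (x t) / t) atTop (𝓝 Λ)) ∧
    (PerturbedODE.RVInfty (fun t => f (PerturbedODE.Finv f t)) (-1) →
      PerturbedODE.RVInfty (PerturbedODE.Finv f) 0 →
      ∃ Λ ∈ Ioo (0 : ℝ) 1,
        (1 - Λ) * Λ⁻¹ = L ∧
        (∀ Λ' : ℝ, 0 < Λ' → (1 - Λ') * Λ'⁻¹ = L → Λ' = Λ) ∧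
        Λ = 1 / (L + 1) ∧
        Tendsto (fun t => PerturbedODE.F f (x t) / t) atTop (𝓝 Λ)) := by
  have h := mainTheorem3_general f g ξ x φ δ L hf_lip.continuous.continuousOn
    (fun u hu => pos_of_mul_pos_right (hf_sign u hu.ne') hu.le) hf_zero.le hF hg_pos hξ hx hδ
    hφ_mono hfφ hL hgL
  exact ⟨h.1, fun β hβ hrv => h.2.1 β hβ hrv.2.2, fun hrv _ => h.2.2 hrv.2.2⟩
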